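/- **Theorem 5.1.** For $x>0$ let $\pi(x)=\#\{p\le x: p \text{ prime}\}$ and $\mathbf p(x)=\pi(x)/x$; let $\operatorname{li}(x)=\int_0^x\frac{du}{\log u}$ (Cauchy principal value), let $\mu=1.45136\ldots$ be the unique positive zero of $\operatorname{li}$, let $H_n=\sum_{k=1}^n\frac1k$, and let $\gamma$ be the Euler–Mascheroni constant. Let $M>0$ and $C\ge\mu$ be constants such that the Riemann hypothesis implies that $$|\pi(x)-\operatorname{li}(x)|\le M\sqrt x\,\log x\qquad\text{for all real } x\ge C.$$ Let $t,r\in\mathbb R$ with $\lceil r\rceil\ge\mu e^{-t}$, put $$\beta(t,r)=\lim_{n\to\infty}\left(\frac{\operatorname{li}(e^tn)}{e^t}-\sum_{r\le k<n}\frac1{H_k-\gamma+t}\right),$$ where $k$ runs over integers, and let $\lambda\in\mathbb R$ with $\lambda\ge\beta(t,r)$. Then each of the following four conditions is equivalent to the Riemann hypothesis. 1. For all integers $n\ge Ce^{-t}$: $\displaystyle\left|\pi(e^tn)-e^t\sum_{r\le k<n}\frac1{H_k-\gamma+t}\right|\le Me^{t/2}\sqrt n\,(t+\log n)+\lambda e^t$.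 2. For all integers $n\ge Ce^{-t}$: $\displaystyle\left|\pi(e^tn)-e^t\sum_{r\le k<n}\frac1{H_k-\gamma+t}\right|\le Me^{t/2}\sqrt n\,(H_n-\gamma+t)+\lambda e^t$. 3. For all integers $n\ge Ce^{-t}$: $\displaystyle\left|\mathbf p(e^tn)-\frac1n\sum_{r\le k<n}\frac1{H_k-\gamma+t}\right|\le\frac{M}{e^{t/2}}\,\frac{t+\log n}{\sqrt n}+\frac{\lambda}{n}$. 4. For all integers $n\ge Ce^{-t}$: $\displaystyle\left|\mathbf p(e^tn)-\frac1n\sum_{r\le k<n}\frac1{H_k-\gamma+t}\right|\le\frac{M}{e^{t/2}}\,\frac{H_n-\gamma+t}{\sqrt n}+\frac{\lambda}{n}$. (The constants $M$ and $C$ are arbitrary subject to the stated hypothesis; the pair $M=\frac1{8\pi}$, $C=2657$ of Schoenfeld's 1976 theorem is an example, quoted from the literature and not part of the assertion.) -/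

import Mathlib

namespace HarmonicRH

/-- The prime counting function at a real argument: the number of primes `p ≤ x`. -/
noncomputable def primePi (x : ℝ) : ℝ := (Nat.primeCounting ⌊x⌋₊ : ℝ)

/-- The prime density function `π(x) / x`. -/
noncomputable def primeDensity (x : ℝ) : ℝ := primePi x / x

/-- The logarithmic integral `li x = ∫₀ˣ du / log u` for `0 < x`, `x ≠ 1`, as a Cauchy principal
value at `u = 1`: the limit, as `ε → 0⁺`, of the integral over the part of `(0, x]` at distance at
least `ε` from `1`. (At `x = 1`, where `li` is `-∞`, the value is meaningless and never used.) -/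
noncomputable def li (x : ℝ) : ℝ :=
  Filter.limUnder (nhdsWithin (0 : ℝ) (Set.Ioi 0)) fun ε : ℝ =>
    ∫ u in {u : ℝ | 0 < u ∧ u ≤ x ∧ ε ≤ |u - 1|}, 1 / Real.log u

/-- The Ramanujan-Soldner constant `1.4513…`, the unique positive zero of `li`
(`li` has the value `-∞` at `1`, so that point is excluded). -/
noncomputable def soldner : ℝ := sInf {x : ℝ | 0 < x ∧ x ≠ 1 ∧ li x = 0}

/-- The sum of `1 / (H_k - γ + t)` over the natural numbers `k` with `r ≤ k < n`. -/
noncomputable def harmonicSum (t r : ℝ) (n : ℕ) : ℝ :=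
  ∑ k ∈ Finset.Ico ⌈r⌉₊ n, 1 / ((harmonic k : ℝ) - Real.eulerMascheroniConstant + t)

/-- The error terms `β_n(t, r) = li(e^t n) / e^t - ∑_{r ≤ k < n} 1 / (H_k - γ + t)`. -/
noncomputable def betaSeq (t r : ℝ) (n : ℕ) : ℝ :=
  li (Real.exp t * n) / Real.exp t - harmonicSum t r n

/-- The limit `β(t, r)` of `β_n(t, r)` as `n → ∞`. -/
noncomputable def beta (t r : ℝ) : ℝ := Filter.limUnder Filter.atTop (betaSeq t r)

end HarmonicRH

section

open Filter Topology MeasureTheory Set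

namespace HarmonicRH

/-! Everything rests on `exp_mul_betaSeq`: writing `S` for the harmonic sum, `π(e^t n) - e^t S = (π
- li)(e^t n) + e^t β_n`, where the last term is bounded. Each increment of `β_n` compares the
integral of `1 / log (e^t u)` over `[n, n + 1]` with `1 / (H_n - γ + t)`. By convexity the integral
is at least the midpoint value `1 / (t + log (n + 1/2))`, and `log (n + 1/2) ≤ H_n - γ`, so `β_n`
increases. The bound `H_n - γ ≤ log (n + 1)` gives a telescoping upper bound, so `β_n` converges.
Since `li ≥ 0` beyond `μ`, this yields `0 ≤ β_n ≤ β ≤ λ` whenever `e^t n ≥ μ` (`betaSeq_mem_Icc`),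
and RH implies the sharpest condition.

Conversely, the conditions with `H_n - γ` are the weaker ones, because `log n ≤ H_n - γ`. They bound
`π - li` by `O(√x log x)` along multiples of `e^t`. Monotonicity of `π` and `li` extends this to
real `x`, and partial summation turns it into `ψ(x) - x = O(x^b)` for every `b > 1/2`
(`psi_sub_isBigO`). The Mellin transform of `ψ(x) - x` then continues the logarithmic derivative of
`(s - 1) ζ(s)` analytically to `Re s > 1/2`, which excludes zeros there. The functional equation
handles the other side (`riemannHypothesis_of_psi_sub_isBigO`). -/

/-! ### The logarithmic integral and its positive zero -/

/-- The integrand `1 / log u` of the logarithmic integral with its pole at `u = 1` removed. -/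
noncomputable def liReg (u : ℝ) : ℝ := 1 / Real.log u - 1 / (u - 1)

/-- Both bounds are the inequalities `1 - 1/u ≤ log u ≤ u - 1` after clearing denominators. At `u =
1` division by zero gives the value `0`. -/
lemma liReg_mem_Icc {u : ℝ} (hu : 0 < u) : liReg u ∈ Icc (0 : ℝ) 1 := by
  unfold liReg
  rcases lt_trichotomy u 1 with h | h | h
  · have hl : Real.log u < 0 := Real.log_neg hu h
    have h1 : Real.log u ≤ u - 1 := Real.log_le_sub_one_of_pos hu
    have h2 : 1 - u⁻¹ ≤ Real.log u := Real.one_sub_inv_le_log_of_pos hu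
    have h3 : u - 1 < 0 := by linarith
    have h4 : u - 1 ≤ u * Real.log u := by
      have := mul_le_mul_of_nonneg_left h2 hu.le
      rwa [mul_sub, mul_inv_cancel₀ hu.ne', mul_one] at this
    rw [div_sub_div _ _ hl.ne h3.ne]
    have hp : 0 < Real.log u * (u - 1) := mul_pos_of_neg_of_neg hl h3
    constructor
    · apply div_nonneg _ hp.le; linarith
    · rw [div_le_one hp]; linarith
  · subst h; simp
  · have hl : 0 < Real.log u := Real.log_pos h
    have h1 : Real.log u ≤ u - 1 := Real.log_le_sub_one_of_pos hu
    have h2 : 1 - u⁻¹ ≤ Real.log u := Real.one_sub_inv_le_log_of_pos hu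
    have h3 : 0 < u - 1 := by linarith
    have h4 : u - 1 ≤ u * Real.log u := by
      have := mul_le_mul_of_nonneg_left h2 hu.le
      rwa [mul_sub, mul_inv_cancel₀ hu.ne', mul_one] at this
    rw [div_sub_div _ _ hl.ne' h3.ne']
    have hp : 0 < Real.log u * (u - 1) := mul_pos hl h3
    constructor
    · apply div_nonneg _ hp.le; linarith
    · rw [div_le_one hp]; linarith

lemma measurable_liReg : Measurable liReg := by
  unfold liReg
  have := Real.measurable_log
  fun_prop

lemma intervalIntegrable_liReg {a b : ℝ} (ha : 0 ≤ a) (hb : 0 ≤ b) :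
    IntervalIntegrable liReg volume a b := by
  rw [intervalIntegrable_iff]
  refine Measure.integrableOn_of_bounded (M := 1) (by simp) measurable_liReg.aestronglyMeasurable ?_
  refine (ae_restrict_mem measurableSet_uIoc).mono fun u hu => ?_
  have hu0 : 0 < u := (le_min ha hb).trans_lt hu.1
  rw [Real.norm_eq_abs, abs_of_nonneg (liReg_mem_Icc hu0).1]
  exact (liReg_mem_Icc hu0).2

lemma integral_one_div_log {a b : ℝ} (ha : 0 ≤ a) (hab : a ≤ b) (h : b < 1 ∨ 1 < a) :
    IntervalIntegrable (fun u => 1 / Real.log u) volume a b ∧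
    ∫ u in a..b, 1 / Real.log u =
      Real.log |b - 1| - Real.log |a - 1| + ∫ u in a..b, liReg u := by
  have h0 : (0 : ℝ) ∉ uIcc (a - 1) (b - 1) := by
    rw [uIcc_of_le (by linarith)]
    rintro ⟨h1, h2⟩
    rcases h with h | h <;> linarith
  have hne : ∀ u ∈ uIcc a b, u - 1 ≠ 0 := by
    intro u hu
    rw [uIcc_of_le hab] at hu
    rcases h with h | h
    · exact ne_of_lt (by linarith [hu.2])
    · exact ne_of_gt (by linarith [hu.1])
  have hi : IntervalIntegrable (fun u : ℝ => 1 / (u - 1)) volume a b := by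
    apply ContinuousOn.intervalIntegrable
    exact continuousOn_const.div (by fun_prop) hne
  have he : (fun u => 1 / Real.log u) = fun u => 1 / (u - 1) + liReg u := by
    ext u; simp [liReg]
  have hr := intervalIntegrable_liReg ha (ha.trans hab)
  refine ⟨by rw [he]; exact hi.add hr, ?_⟩
  rw [he, intervalIntegral.integral_add hi hr,
    intervalIntegral.integral_comp_sub_right (fun u => 1 / u) 1, integral_one_div h0,
    Real.log_div, Real.log_abs, Real.log_abs]
  · exact hne b right_mem_uIcc
  · exact hne a left_mem_uIcc

/-- The poles on the two sides of `1` contribute `log ε` and `-log ε`, which cancel; only the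
bounded part over the removed window depends on `ε`. -/
lemma truncated_li {x ε : ℝ} (hε : 0 < ε) (hε1 : ε < 1) (hx : ε < x - 1) :
    ∫ u in {u : ℝ | 0 < u ∧ u ≤ x ∧ ε ≤ |u - 1|}, 1 / Real.log u =
      Real.log (x - 1) + (∫ u in 0..x, liReg u) - ∫ u in (1 - ε)..(1 + ε), liReg u := by
  have hset : {u : ℝ | 0 < u ∧ u ≤ x ∧ ε ≤ |u - 1|} = Ioc 0 (1 - ε) ∪ Icc (1 + ε) x := by
    ext u
    simp only [mem_ofPred_eq, mem_union, mem_Ioc, mem_Icc, le_abs]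
    constructor
    · rintro ⟨h1, h2, h3 | h3⟩
      · right; constructor <;> linarith
      · left; constructor <;> linarith
    · rintro (⟨h1, h2⟩ | ⟨h1, h2⟩)
      · exact ⟨h1, by linarith, Or.inr (by linarith)⟩
      · exact ⟨by linarith, h2, Or.inl (by linarith)⟩
  obtain ⟨i1, e1⟩ := integral_one_div_log le_rfl (by linarith : 0 ≤ 1 - ε) (Or.inl (by linarith))
  obtain ⟨i2, e2⟩ := integral_one_div_log (by linarith : 0 ≤ 1 + ε) (by linarith : 1 + ε ≤ x)
    (Or.inr (by linarith))
  rw [intervalIntegrable_iff_integrableOn_Ioc_of_le (by linarith)] at i1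
  rw [intervalIntegrable_iff_integrableOn_Icc_of_le (by linarith)] at i2
  rw [hset, setIntegral_union _ measurableSet_Icc i1 i2, integral_Icc_eq_integral_Ioc,
    ← intervalIntegral.integral_of_le (by linarith), ← intervalIntegral.integral_of_le (by linarith),
    e1, e2]
  · have a1 := intervalIntegral.integral_add_adjacent_intervals
      (intervalIntegrable_liReg le_rfl (by linarith : 0 ≤ 1 - ε))
      (intervalIntegrable_liReg (by linarith : 0 ≤ 1 - ε) (by linarith : 0 ≤ 1 + ε))
    have a2 := intervalIntegral.integral_add_adjacent_intervals
      (intervalIntegrable_liReg le_rfl (by linarith : 0 ≤ 1 + ε))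
      (intervalIntegrable_liReg (by linarith : 0 ≤ 1 + ε) (by linarith : 0 ≤ x))
    rw [← a2, ← a1]
    have l1 : |1 - ε - 1| = ε := by rw [abs_of_neg] <;> linarith
    have l2 : |1 + ε - 1| = ε := by rw [abs_of_pos] <;> linarith
    have l3 : |x - 1| = x - 1 := abs_of_pos (by linarith)
    rw [l1, l2, l3]
    simp
    ring
  · rw [Set.disjoint_left]
    rintro u ⟨_, h1⟩ ⟨h2, _⟩
    linarith

lemma li_eq {x : ℝ} (hx : 1 < x) : li x = Real.log (x - 1) + ∫ u in 0..x, liReg u := by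
  apply Tendsto.limUnder_eq
  have hd : Tendsto (fun ε : ℝ => ∫ u in (1 - ε)..(1 + ε), liReg u) (𝓝[>] 0) (𝓝 0) := by
    apply squeeze_zero_norm' (a := fun ε : ℝ => 2 * ε)
    · filter_upwards [Ioo_mem_nhdsGT (zero_lt_one : (0 : ℝ) < 1)] with ε hε
      have := intervalIntegral.norm_integral_le_of_norm_le_const (f := liReg) (a := 1 - ε)
        (b := 1 + ε) (C := 1) ?_
      · rw [abs_of_nonneg (by linarith [hε.1])] at this
        linarith
      · intro u hu
        rw [uIoc_of_le (by linarith [hε.1])] at hu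
        have hu0 : 0 < u := by linarith [hu.1, hε.2]
        rw [Real.norm_eq_abs, abs_of_nonneg (liReg_mem_Icc hu0).1]
        exact (liReg_mem_Icc hu0).2
    · have : Tendsto (fun ε : ℝ => 2 * ε) (𝓝 0) (𝓝 (2 * 0)) := by
        apply Continuous.tendsto; fun_prop
      rw [mul_zero] at this
      exact this.mono_left nhdsWithin_le_nhds
  have := (tendsto_const_nhds (x := Real.log (x - 1) + ∫ u in 0..x, liReg u)).sub hd
  rw [sub_zero] at this
  refine this.congr' ?_
  filter_upwards [Ioo_mem_nhdsGT (zero_lt_one : (0 : ℝ) < 1),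
    Ioo_mem_nhdsGT (by linarith : (0 : ℝ) < x - 1)] with ε h1 h2
  exact (truncated_li h1.1 h1.2 h2.2).symm

lemma hasDerivAt_li {x : ℝ} (hx : 1 < x) : HasDerivAt li (1 / Real.log x) x := by
  have hl : Real.log x ≠ 0 := (Real.log_pos hx).ne'
  have hx1 : x - 1 ≠ 0 := by linarith
  have hc : ContinuousAt liReg x := by
    unfold liReg
    have h0 : x ≠ 0 := by linarith
    fun_prop (disch := assumption)
  have h1 : HasDerivAt (fun y => ∫ u in 0..y, liReg u) (liReg x) x :=
    intervalIntegral.integral_hasDerivAt_right (intervalIntegrable_liReg le_rfl (by linarith))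
      measurable_liReg.stronglyMeasurable.stronglyMeasurableAtFilter hc
  have h2 : HasDerivAt (fun y : ℝ => Real.log (y - 1)) (1 / (x - 1)) x := by
    simpa using ((hasDerivAt_id x).sub_const 1).log hx1
  have h3 := h2.add h1
  have e : 1 / (x - 1) + liReg x = 1 / Real.log x := by simp [liReg]
  rw [e] at h3
  refine h3.congr_of_eventuallyEq ?_
  filter_upwards [lt_mem_nhds hx] with y hy
  rw [li_eq hy]; rfl

lemma strictMonoOn_li : StrictMonoOn li (Ioi 1) := by
  apply strictMonoOn_of_deriv_pos (convex_Ioi 1)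
  · exact fun x hx => (hasDerivAt_li hx).continuousAt.continuousWithinAt
  · intro x hx
    rw [interior_Ioi] at hx
    rw [(hasDerivAt_li hx).deriv]
    exact one_div_pos.2 (Real.log_pos hx)

/-- For `ε < 1 - x` the truncation removes nothing, so the limit is an ordinary integral of a
negative function. -/
lemma li_neg_of_lt_one {x : ℝ} (h0 : 0 < x) (h1 : x < 1) : li x < 0 := by
  have hlim : li x = ∫ u in 0..x, 1 / Real.log u := by
    apply Tendsto.limUnder_eq
    refine tendsto_const_nhds.congr' ?_
    filter_upwards [Ioo_mem_nhdsGT (by linarith : (0 : ℝ) < 1 - x)] with ε hε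
    rw [intervalIntegral.integral_of_le h0.le]
    congr 2
    ext u
    simp only [mem_ofPred_eq, mem_Ioc, le_abs]
    refine ⟨fun h => ⟨h.1, h.2, Or.inr (by linarith [h.2, hε.2])⟩, fun h => ⟨h.1, h.2.1⟩⟩
  obtain ⟨hi, -⟩ := integral_one_div_log le_rfl h0.le (Or.inl h1)
  have : 0 < ∫ u in 0..x, -(1 / Real.log u) := by
    apply intervalIntegral.intervalIntegral_pos_of_pos_on hi.neg _ h0
    intro u hu
    change 0 < -(1 / Real.log u)
    rw [neg_pos]
    exact one_div_neg.2 (Real.log_neg hu.1 (hu.2.trans h1))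
  rw [intervalIntegral.integral_neg] at this
  rw [hlim]; linarith

lemma exists_li_eq_zero : ∃ m : ℝ, 1 < m ∧ li m = 0 := by
  -- Here `log (x - 1) = -3`, while the regular part is at most `x < 2`.
  have hneg : li (1 + Real.exp (-3)) < 0 := by
    have he : Real.exp (-3) < 1 := by simp
    have hp := Real.exp_pos (-3)
    rw [li_eq (by linarith), add_sub_cancel_left, Real.log_exp]
    have := intervalIntegral.norm_integral_le_of_norm_le_const (f := liReg) (a := 0)
        (b := 1 + Real.exp (-3)) (C := 1) ?_
    · rw [sub_zero, abs_of_pos (by linarith), Real.norm_eq_abs] at this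
      linarith [le_abs_self (∫ u in 0..(1 + Real.exp (-3)), liReg u)]
    · intro u hu
      rw [uIoc_of_le (by linarith)] at hu
      rw [Real.norm_eq_abs, abs_of_nonneg (liReg_mem_Icc hu.1).1]
      exact (liReg_mem_Icc hu.1).2
  have hpos : 0 ≤ li 2 := by
    rw [li_eq one_lt_two]
    norm_num
    apply intervalIntegral.integral_nonneg_of_ae_restrict two_pos.le
    rw [Filter.EventuallyLE, ← restrict_Ioc_eq_restrict_Icc]
    exact (ae_restrict_mem measurableSet_Ioc).mono fun u hu => (liReg_mem_Icc hu.1).1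
  have hp := Real.exp_pos (-3)
  have he : Real.exp (-3) < 1 := by simp
  have hcont : ContinuousOn li (Icc (1 + Real.exp (-3)) 2) := fun x hx =>
    (hasDerivAt_li (by linarith [hx.1])).continuousAt.continuousWithinAt
  obtain ⟨m, hm, hm0⟩ := intermediate_value_Icc (by linarith) hcont ⟨hneg.le, hpos⟩
  exact ⟨m, by linarith [hm.1], hm0⟩

lemma one_lt_soldner_and_li_soldner : 1 < soldner ∧ li soldner = 0 := by
  obtain ⟨m, hm, hm0⟩ := exists_li_eq_zero
  have hs : {x : ℝ | 0 < x ∧ x ≠ 1 ∧ li x = 0} = {m} := by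
    ext x
    simp only [mem_ofPred_eq, mem_singleton_iff]
    constructor
    · rintro ⟨h0, h1, h2⟩
      rcases lt_or_gt_of_ne h1 with h | h
      · exact absurd h2 (li_neg_of_lt_one h0 h).ne
      · exact strictMonoOn_li.injOn h hm (h2.trans hm0.symm)
    · rintro rfl
      exact ⟨by linarith, hm.ne', hm0⟩
  rw [soldner, hs, csInf_singleton]
  exact ⟨hm, hm0⟩

lemma one_lt_soldner : 1 < soldner := one_lt_soldner_and_li_soldner.1

lemma li_nonneg {x : ℝ} (hx : soldner ≤ x) : 0 ≤ li x := by
  rw [← one_lt_soldner_and_li_soldner.2]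
  exact strictMonoOn_li.monotoneOn one_lt_soldner (one_lt_soldner.trans_le hx) hx

/-! ### Increments of `li` -/

/-- Midpoint inequality for the convex function `1 / log`, obtained by differentiating in the
half-width of the interval. -/
lemma two_mul_div_log_le_li_sub {m d : ℝ} (hd : 0 ≤ d) (hm : 1 < m - d) :
    2 * d / Real.log m ≤ li (m + d) - li (m - d) := by
  set g : ℝ → ℝ := fun s => li (m + s) - li (m - s) - 2 * s / Real.log m with hg
  have hderiv : ∀ s ∈ Icc 0 d, HasDerivAt g
      (1 / Real.log (m + s) + 1 / Real.log (m - s) - 2 / Real.log m) s := by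
    intro s hs
    have h1 : HasDerivAt (fun s => li (m + s)) (1 / Real.log (m + s)) s :=
      (hasDerivAt_li (by linarith [hs.1])).comp_const_add m s
    have h2 : HasDerivAt (fun s => li (m - s)) (-(1 / Real.log (m - s))) s :=
      (hasDerivAt_li (by linarith [hs.2])).comp_const_sub m s
    have h3 : HasDerivAt (fun s : ℝ => 2 * s / Real.log m) (2 / Real.log m) s := by
      simpa using ((hasDerivAt_id s).const_mul 2).div_const (Real.log m)
    convert! (h1.sub h2).sub h3 using 1
    ring
  have hmono : MonotoneOn g (Icc 0 d) := by
    apply monotoneOn_of_deriv_nonneg (convex_Icc 0 d)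
    · exact fun s hs => (hderiv s hs).continuousAt.continuousWithinAt
    · exact fun s hs => (hderiv s (interior_subset hs)).differentiableAt.differentiableWithinAt
    · intro s hs
      have hs' := interior_subset hs
      rw [(hderiv s hs').deriv]
      have a0 : 0 < Real.log (m - s) := Real.log_pos (by linarith [hs'.2])
      have b0 : 0 < Real.log (m + s) := Real.log_pos (by linarith [hs'.1])
      have c0 : 0 < Real.log m := Real.log_pos (by linarith)
      have hsum : Real.log (m + s) + Real.log (m - s) ≤ 2 * Real.log m := by
        rw [← Real.log_mul (by linarith [hs'.1]) (by linarith [hs'.2]), ← Nat.cast_two,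
          ← Real.log_pow]
        apply Real.log_le_log
        · exact mul_pos (by linarith [hs'.1]) (by linarith [hs'.2])
        · nlinarith [sq_nonneg s]
      -- With `a`, `b` the outer logarithms and `c = log m`: `4ab ≤ (a + b)² ≤ 2c(a + b)`.
      rw [div_add_div _ _ b0.ne' a0.ne', sub_nonneg, div_le_div_iff₀ c0 (mul_pos b0 a0)]
      nlinarith [sq_nonneg (Real.log (m + s) - Real.log (m - s)),
        mul_le_mul_of_nonneg_left hsum (add_pos b0 a0).le]
  have := hmono (left_mem_Icc.2 hd) (right_mem_Icc.2 hd) hd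
  simp only [hg] at this
  norm_num at this
  linarith

lemma li_sub_le {x y : ℝ} (hx : 1 < x) (hxy : x ≤ y) : li y - li x ≤ (y - x) / Real.log x := by
  have hl := Real.log_pos hx
  have := (convex_Icc x y).image_sub_le_mul_sub_of_deriv_le (f := li) (C := 1 / Real.log x)
    (fun z hz => (hasDerivAt_li (hx.trans_le hz.1)).continuousAt.continuousWithinAt)
    (fun z hz => (hasDerivAt_li
      (hx.trans_le (interior_subset hz).1)).differentiableAt.differentiableWithinAt)
    (fun z hz => by
      have hz' := (interior_subset hz).1
      rw [(hasDerivAt_li (hx.trans_le hz')).deriv]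
      exact one_div_le_one_div_of_le hl (Real.log_le_log (by linarith) hz'))
    x (left_mem_Icc.2 hxy) y (right_mem_Icc.2 hxy) hxy
  rwa [one_div_mul_eq_div] at this

/-! ### Harmonic numbers against logarithms -/

lemma one_div_add_one_le_log_sub_log (n : ℕ) :
    1 / ((n : ℝ) + 1) ≤ Real.log ((n + 1 : ℕ) + 1 / 2) - Real.log (n + 1 / 2) := by
  have ha : (0 : ℝ) < n + 1 / 2 := by positivity
  have h := Real.hasSum_log_one_add_inv ha
  -- The series for `log (1 + 1/a)` in odd powers of `1 / (2a + 1)` has positive terms; at `a = n +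
  -- 1/2` its first term is exactly `1 / (n + 1)`.
  have h0 := h.summable.le_tsum 0 (fun j _ => by positivity)
  rw [h.tsum_eq] at h0
  rw [← Real.log_div (by positivity) ha.ne']
  have e1 : ((n + 1 : ℕ) + 1 / 2 : ℝ) / (n + 1 / 2) = 1 + ((n : ℝ) + 1 / 2)⁻¹ := by
    push_cast; field_simp; ring
  rw [e1]
  refine le_trans (le_of_eq ?_) h0
  norm_num
  field_simp
  ring

/-- `H_n - log (n + 1/2)` decreases to `γ`. The shift `1/2` is what matches the midpoint inequality
for `li`. -/
lemma log_add_half_le_harmonic_sub (n : ℕ) :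
    Real.log (n + 1 / 2) ≤ harmonic n - Real.eulerMascheroniConstant := by
  have hanti : Antitone fun n : ℕ => (harmonic n : ℝ) - Real.log (n + 1 / 2) := by
    refine antitone_nat_of_succ_le fun k => ?_
    have := one_div_add_one_le_log_sub_log k
    rw [harmonic_succ]
    push_cast at this ⊢
    rw [one_div] at this
    linarith
  have hlim : Tendsto (fun n : ℕ => (harmonic n : ℝ) - Real.log (n + 1 / 2)) atTop
      (𝓝 Real.eulerMascheroniConstant) := by
    refine tendsto_of_tendsto_of_tendsto_of_le_of_le' Real.tendsto_harmonic_sub_log_add_one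
      Real.tendsto_harmonic_sub_log ?_ ?_
    · filter_upwards with k
      have : Real.log (k + 1 / 2 : ℝ) ≤ Real.log (k + 1) :=
        Real.log_le_log (by positivity) (by linarith)
      linarith
    · filter_upwards [eventually_gt_atTop 0] with k hk
      have hk' : (0 : ℝ) < k := by exact_mod_cast hk
      have : Real.log (k : ℝ) ≤ Real.log (k + 1 / 2) :=
        Real.log_le_log hk' (by linarith)
      linarith
  have := hanti.le_of_tendsto hlim n
  linarith

lemma log_le_harmonic_sub {n : ℕ} (hn : 0 < n) :
    Real.log n ≤ harmonic n - Real.eulerMascheroniConstant := by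
  have hn' : (0 : ℝ) < n := by exact_mod_cast hn
  exact (Real.log_le_log hn' (by linarith)).trans (log_add_half_le_harmonic_sub n)

lemma harmonic_sub_le_log_add_one (n : ℕ) :
    harmonic n - Real.eulerMascheroniConstant ≤ Real.log (n + 1) := by
  have := (Real.eulerMascheroniSeq_lt_eulerMascheroniConstant n).le
  rw [Real.eulerMascheroniSeq] at this
  linarith

lemma log_exp_mul (t : ℝ) {x : ℝ} (hx : x ≠ 0) : Real.log (Real.exp t * x) = t + Real.log x := by
  rw [Real.log_mul (Real.exp_pos t).ne' hx, Real.log_exp]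

/-! ### Monotonicity and convergence of `β_n` -/

section betaSeq

variable {t r : ℝ}

lemma pos_of_soldner_le {n : ℕ} (hn : soldner ≤ Real.exp t * n) : 0 < n := by
  rcases Nat.eq_zero_or_pos n with rfl | h
  · have := one_lt_soldner
    norm_num at hn
    linarith
  · exact h

lemma soldner_le_of_le {m n : ℕ} (hm : soldner ≤ Real.exp t * m) (hmn : m ≤ n) :
    soldner ≤ Real.exp t * n := by
  have : (m : ℝ) ≤ n := by exact_mod_cast hmn
  exact hm.trans (mul_le_mul_of_nonneg_left this (Real.exp_pos t).le)

lemma add_log_pos {n : ℕ} (hn : soldner ≤ Real.exp t * n) : 0 < t + Real.log n := by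
  have h0 : (n : ℝ) ≠ 0 := by exact_mod_cast (pos_of_soldner_le hn).ne'
  rw [← log_exp_mul t h0]
  exact Real.log_pos (one_lt_soldner.trans_le hn)

lemma soldner_le_exp_mul_ceil (hr : soldner * Real.exp (-t) ≤ (⌈r⌉ : ℝ)) :
    soldner ≤ Real.exp t * ⌈r⌉₊ := by
  have h0 : (0 : ℝ) < ⌈r⌉ :=
    (mul_pos (zero_lt_one.trans one_lt_soldner) (Real.exp_pos _)).trans_le hr
  have h1 : (⌈r⌉ : ℝ) = (⌈r⌉₊ : ℝ) := by
    have : (⌈r⌉₊ : ℤ) = ⌈r⌉ := by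
      rw [Int.ceil_toNat r |>.symm]
      exact Int.toNat_of_nonneg (by exact_mod_cast h0.le)
    rw [← this]; simp
  rw [← h1]
  have := mul_le_mul_of_nonneg_left hr (Real.exp_pos t).le
  rwa [mul_left_comm, ← Real.exp_add, add_neg_cancel, Real.exp_zero, mul_one] at this

/-- The midpoint of `[e^t n, e^t (n + 1)]` is `e^t (n + 1/2)`, so the increment of `li / e^t` is at
least `1 / (t + log (n + 1/2))`, which dominates the new summand. -/
lemma betaSeq_le_succ_of_le {n : ℕ} (hn : soldner ≤ Real.exp t * n) (hrn : ⌈r⌉₊ ≤ n) :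
    betaSeq t r n ≤ betaSeq t r (n + 1) := by
  have h0 := pos_of_soldner_le hn
  have hn0 : (0 : ℝ) < n := by exact_mod_cast h0
  have he := Real.exp_pos t
  have hmid := two_mul_div_log_le_li_sub (m := Real.exp t * (n + 1 / 2)) (d := Real.exp t / 2)
    (by positivity) (by
      have := one_lt_soldner
      linarith)
  have e1 : Real.exp t * (n + 1 / 2) + Real.exp t / 2 = Real.exp t * (n + 1 : ℕ) := by
    push_cast; ring
  have e2 : Real.exp t * (n + 1 / 2) - Real.exp t / 2 = Real.exp t * n := by ring
  rw [e1, e2, log_exp_mul t (by positivity), mul_div_cancel₀ _ (two_ne_zero' ℝ)] at hmid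
  have hlog := add_log_pos hn
  have hlog' : Real.log n ≤ Real.log (n + 1 / 2 : ℝ) := Real.log_le_log hn0 (by linarith)
  have hH := log_add_half_le_harmonic_sub n
  have h1 : 1 / ((harmonic n : ℝ) - Real.eulerMascheroniConstant + t) ≤
      1 / (t + Real.log (n + 1 / 2)) :=
    one_div_le_one_div_of_le (by linarith) (by linarith)
  have h2 : 1 / (t + Real.log (n + 1 / 2)) ≤
      li (Real.exp t * (n + 1 : ℕ)) / Real.exp t - li (Real.exp t * n) / Real.exp t := by
    rw [← sub_div, le_div_iff₀ he, one_div_mul_eq_div]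
    exact hmid
  rw [betaSeq, betaSeq, harmonicSum, harmonicSum, Finset.sum_Ico_succ_top hrn]
  linarith

/-- Adding `1 / (t + log n)` makes the sequence decreasing, which gives the upper bound needed for
convergence. -/
lemma betaSeq_succ_le {n : ℕ} (hn : soldner ≤ Real.exp t * n) (hrn : ⌈r⌉₊ ≤ n) :
    betaSeq t r (n + 1) + 1 / (t + Real.log (n + 1 : ℕ)) ≤
      betaSeq t r n + 1 / (t + Real.log n) := by
  have h0 := pos_of_soldner_le hn
  have hn0 : (0 : ℝ) < n := by exact_mod_cast h0
  have he := Real.exp_pos t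
  have hli := li_sub_le (x := Real.exp t * n) (y := Real.exp t * (n + 1 : ℕ))
    (one_lt_soldner.trans_le hn) (by push_cast; nlinarith)
  have e1 : Real.exp t * (n + 1 : ℕ) - Real.exp t * n = Real.exp t := by push_cast; ring
  rw [e1, log_exp_mul t hn0.ne'] at hli
  have hlog := add_log_pos hn
  have hH := harmonic_sub_le_log_add_one n
  have hH' := log_le_harmonic_sub h0
  have h1 : 1 / (t + Real.log (n + 1 : ℕ)) ≤
      1 / ((harmonic n : ℝ) - Real.eulerMascheroniConstant + t) := by
    push_cast
    exact one_div_le_one_div_of_le (by linarith) (by linarith)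
  have h2 : li (Real.exp t * (n + 1 : ℕ)) / Real.exp t - li (Real.exp t * n) / Real.exp t ≤
      1 / (t + Real.log n) := by
    rw [← sub_div, div_le_iff₀ he, one_div_mul_eq_div]
    exact hli
  rw [betaSeq, betaSeq, harmonicSum, harmonicSum, Finset.sum_Ico_succ_top hrn]
  linarith

lemma harmonicSum_of_le {n : ℕ} (h : n ≤ ⌈r⌉₊) : harmonicSum t r n = 0 := by
  rw [harmonicSum, Finset.Ico_eq_empty_of_le h, Finset.sum_empty]

lemma betaSeq_le_succ {n : ℕ} (hn : soldner ≤ Real.exp t * n) :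
    betaSeq t r n ≤ betaSeq t r (n + 1) := by
  rcases le_or_gt ⌈r⌉₊ n with h | h
  · exact betaSeq_le_succ_of_le hn h
  -- Before the sum starts, `β_n` is just `li (e^t n) / e^t`.
  · rw [betaSeq, betaSeq, harmonicSum_of_le h.le, harmonicSum_of_le h, sub_zero, sub_zero]
    have h1 := one_lt_soldner.trans_le hn
    have h2 : Real.exp t * n ≤ Real.exp t * (n + 1 : ℕ) := by
      push_cast; nlinarith [Real.exp_pos t]
    exact div_le_div_of_nonneg_right
      (strictMonoOn_li.monotoneOn h1 (h1.trans_le h2) h2) (Real.exp_pos t).le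

lemma betaSeq_le_of_le {m n : ℕ} (hm : soldner ≤ Real.exp t * m) (hmn : m ≤ n) :
    betaSeq t r m ≤ betaSeq t r n := by
  induction n, hmn using Nat.le_induction with
  | base => exact le_rfl
  | succ k hk ih => exact ih.trans (betaSeq_le_succ (soldner_le_of_le hm hk))

lemma tendsto_betaSeq (hr : soldner * Real.exp (-t) ≤ (⌈r⌉ : ℝ)) :
    Tendsto (betaSeq t r) atTop (𝓝 (beta t r)) := by
  have hN := soldner_le_exp_mul_ceil hr
  set N := ⌈r⌉₊ with hNdef
  have hbound : ∀ n, N ≤ n → betaSeq t r n + 1 / (t + Real.log n) ≤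
      betaSeq t r N + 1 / (t + Real.log N) := by
    intro n hn
    induction n, hn using Nat.le_induction with
    | base => exact le_rfl
    | succ k hk ih => exact (betaSeq_succ_le (soldner_le_of_le hN hk) hk).trans ih
  have hmono : Monotone fun k => betaSeq t r (k + N) := fun a b hab =>
    betaSeq_le_of_le (soldner_le_of_le hN (Nat.le_add_left _ _)) (by omega)
  have hbdd : BddAbove (range fun k => betaSeq t r (k + N)) := by
    refine ⟨betaSeq t r N + 1 / (t + Real.log N), ?_⟩
    rintro _ ⟨k, rfl⟩
    have h1 := hbound (k + N) (Nat.le_add_left _ _)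
    have h2 : 0 < 1 / (t + Real.log (k + N : ℕ)) :=
      one_div_pos.2 (add_log_pos (soldner_le_of_le hN (Nat.le_add_left _ _)))
    dsimp only
    linarith
  have hlim := (tendsto_add_atTop_iff_nat N).1 (tendsto_atTop_ciSup hmono hbdd)
  rw [beta, hlim.limUnder_eq]
  exact hlim

lemma betaSeq_mem_Icc (hr : soldner * Real.exp (-t) ≤ (⌈r⌉ : ℝ)) {n : ℕ}
    (hn : soldner ≤ Real.exp t * n) : betaSeq t r n ∈ Icc 0 (beta t r) := by
  have base : ∀ m ≤ ⌈r⌉₊, soldner ≤ Real.exp t * m → 0 ≤ betaSeq t r m := by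
    intro m hm hm'
    rw [betaSeq, harmonicSum_of_le hm, sub_zero]
    exact div_nonneg (li_nonneg hm') (Real.exp_pos t).le
  constructor
  · rcases le_total n ⌈r⌉₊ with h | h
    · exact base n h hn
    · have hN := soldner_le_exp_mul_ceil hr
      exact (base _ le_rfl hN).trans (betaSeq_le_of_le hN h)
  · refine ge_of_tendsto (tendsto_betaSeq hr) ?_
    filter_upwards [eventually_ge_atTop n] with k hk using betaSeq_le_of_le hn hk

end betaSeq

/-! ### From `ψ(x) - x = O(x^b)` to the Riemann hypothesis -/

/-- The entire function `(s - 1) ζ(s)`. -/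
noncomputable def zetaMulSub : ℂ → ℂ := Function.update (fun s => (s - 1) * riemannZeta s) 1 1

lemma zetaMulSub_of_ne_one {s : ℂ} (hs : s ≠ 1) : zetaMulSub s = (s - 1) * riemannZeta s :=
  Function.update_of_ne hs ..

lemma differentiable_zetaMulSub : Differentiable ℂ zetaMulSub := by
  rw [← differentiableOn_univ,
    ← Complex.differentiableOn_compl_singleton_and_continuousAt_iff (c := 1) Filter.univ_mem]
  refine ⟨DifferentiableOn.congr (f := fun s ↦ (s - 1) * riemannZeta s)
    (fun s hs ↦ DifferentiableAt.differentiableWithinAt ?_)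
    fun s hs ↦ zetaMulSub_of_ne_one (Set.mem_sdiff_singleton.mp hs).2,
    continuousWithinAt_compl_self.mp ?_⟩
  · have := differentiableAt_riemannZeta (Set.mem_sdiff_singleton.mp hs).2
    fun_prop
  · simpa [zetaMulSub] using riemannZeta_residue_one

lemma deriv_zetaMulSub {s : ℂ} (hs : s ≠ 1) :
    deriv zetaMulSub s = riemannZeta s + (s - 1) * deriv riemannZeta s := by
  have H : zetaMulSub =ᶠ[𝓝 s] fun w ↦ (w - 1) * riemannZeta w :=
    (eventually_ne_nhds hs).mono fun w hw => zetaMulSub_of_ne_one hw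
  rw [H.deriv_eq, deriv_fun_mul (by fun_prop) (differentiableAt_riemannZeta hs), deriv_sub_const,
    deriv_id'', one_mul]

/-- The error term `ψ(x) - x` of the prime number theorem, cut off below `1`. -/
noncomputable def psiError : ℝ → ℂ :=
  indicator (Ioi 1) fun x => ((Chebyshev.psi x - x : ℝ) : ℂ)

lemma locallyIntegrableOn_psiError : LocallyIntegrableOn psiError (Ioi 0) := by
  have h0 : LocallyIntegrable (fun x : ℝ => Chebyshev.psi x - x) :=
    (Chebyshev.psi_mono.locallyIntegrable (μ := volume)).sub
      (continuous_id.locallyIntegrable (μ := volume))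
  have h : LocallyIntegrable (fun x : ℝ => ((Chebyshev.psi x - x : ℝ) : ℂ)) :=
    h0.mono (Complex.measurable_ofReal.comp
      (Chebyshev.psi_mono.measurable.sub measurable_id)).aestronglyMeasurable
      (Eventually.of_forall fun x => (Complex.norm_real _).le)
  exact (h.indicator measurableSet_Ioi).locallyIntegrableOn _

lemma psiError_isBigO_zero (b : ℝ) :
    psiError =O[𝓝[>] 0] fun x : ℝ => x ^ (-b) := by
  refine (Asymptotics.isBigO_zero _ _).congr' ?_ EventuallyEq.rfl
  filter_upwards [Ioo_mem_nhdsGT (zero_lt_one : (0 : ℝ) < 1)] with x hx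
  rw [psiError, indicator_of_notMem]
  exact not_lt.2 hx.2.le

section

variable (h : ∀ b : ℝ, 1 / 2 < b →
  (fun x => Chebyshev.psi x - x) =O[atTop] fun x : ℝ => x ^ b)

include h

lemma psiError_isBigO_atTop {b : ℝ} (hb : 1 / 2 < b) :
    psiError =O[atTop] fun x : ℝ => x ^ (-(-b)) := by
  rw [neg_neg]
  refine (Complex.isBigO_ofReal_left.2 (h b hb)).congr' ?_ EventuallyEq.rfl
  filter_upwards [eventually_gt_atTop 1] with x hx
  rw [psiError, indicator_of_mem (mem_Ioi.2 hx)]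

lemma mellinConvergent_psiError {s : ℂ} (hs : 1 / 2 < s.re) :
    MellinConvergent psiError (-s) := by
  obtain ⟨b, hb, hbs⟩ := exists_between hs
  exact mellinConvergent_of_isBigO_rpow locallyIntegrableOn_psiError (psiError_isBigO_atTop h hb)
    (by simpa using hbs) (psiError_isBigO_zero ((-s).re - 1)) (by linarith)

lemma differentiableAt_mellin_psiError {s : ℂ} (hs : 1 / 2 < s.re) :
    DifferentiableAt ℂ (fun z => mellin psiError (-z)) s := by
  obtain ⟨b, hb, hbs⟩ := exists_between hs
  have : DifferentiableAt ℂ (mellin psiError) (-s) :=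
    mellin_differentiableAt_of_isBigO_rpow locallyIntegrableOn_psiError
      (psiError_isBigO_atTop h hb) (by simpa using hbs)
      (psiError_isBigO_zero ((-s).re - 1)) (by linarith)
  exact this.comp s differentiable_neg.differentiableAt

/-- Abel summation gives `s ∫ ψ(x) x^(-s-1) dx` over `x > 1`; splitting `ψ(x) = (ψ(x) - x) + x`
isolates the pole as `∫ x^(-s) dx = 1 / (s - 1)`. -/
lemma neg_deriv_zeta_div_zeta_eq {s : ℂ} (hs : 1 < s.re) :
    -deriv riemannZeta s / riemannZeta s = s * (mellin psiError (-s) + 1 / (s - 1)) := by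
  have hs1 : s - 1 ≠ 0 := by
    intro h0
    rw [sub_eq_zero.1 h0] at hs
    simp at hs
  have hsum : ∀ x : ℝ, ∑ k ∈ Finset.Icc 1 ⌊x⌋₊, ArithmeticFunction.vonMangoldt k =
      Chebyshev.psi x := fun x => rfl
  have hO : (fun n : ℕ => ∑ k ∈ Finset.Icc 1 n, ArithmeticFunction.vonMangoldt k) =O[atTop]
      fun n : ℕ => (n : ℝ) ^ (1 : ℝ) := by
    obtain ⟨c, hc⟩ : ∃ c : ℝ, ∀ x : ℝ, 0 ≤ x → Chebyshev.psi x ≤ c * x :=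
      ⟨_, fun x hx => Chebyshev.psi_le_const_mul_self hx⟩
    refine Asymptotics.IsBigO.of_bound c (Eventually.of_forall fun n => ?_)
    have h1 := hsum n
    rw [Nat.floor_natCast] at h1
    rw [h1, Real.norm_of_nonneg (Chebyshev.psi_nonneg _), Real.rpow_one, Real.norm_natCast]
    exact hc n n.cast_nonneg
  rw [← ArithmeticFunction.LSeries_vonMangoldt_eq_deriv_riemannZeta_div hs,
    LSeries_eq_mul_integral_of_nonneg _ zero_le_one hs hO
      fun n => ArithmeticFunction.vonMangoldt_nonneg]
  congr 1
  have hre : (-s).re < -1 := by simpa using hs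
  have hpow := integral_Ioi_cpow_of_lt hre zero_lt_one
  have hpowi := integrableOn_Ioi_cpow_of_lt hre zero_lt_one
  have hmel := mellinConvergent_psiError h (by linarith : 1 / 2 < s.re)
  have hind : (fun x : ℝ => (x : ℂ) ^ (-s - 1) • psiError x) =
      indicator (Ioi 1) fun x : ℝ => (x : ℂ) ^ (-s - 1) * ((Chebyshev.psi x - x : ℝ) : ℂ) := by
    ext x
    rw [psiError, smul_eq_mul]
    by_cases hx : x ∈ Ioi (1 : ℝ) <;> simp [hx]
  have hsub : Ioi (0 : ℝ) ∩ Ioi 1 = Ioi 1 :=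
    inter_eq_right.2 (Ioi_subset_Ioi zero_le_one)
  rw [MellinConvergent, hind, IntegrableOn, integrable_indicator_iff measurableSet_Ioi,
    IntegrableOn, Measure.restrict_restrict measurableSet_Ioi, inter_comm, hsub] at hmel
  have e1 : mellin psiError (-s) =
      ∫ x in Ioi (1 : ℝ), (x : ℂ) ^ (-s - 1) * ((Chebyshev.psi x - x : ℝ) : ℂ) := by
    rw [mellin, hind, setIntegral_indicator measurableSet_Ioi, hsub]
  have e2 : 1 / (s - 1) = ∫ x in Ioi (1 : ℝ), (x : ℂ) ^ (-s) := by
    rw [hpow]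
    have : -s + 1 ≠ 0 := by
      intro h0; apply hs1; linear_combination -h0
    rw [Complex.ofReal_one, Complex.one_cpow, div_eq_div_iff hs1 this]
    ring
  rw [e1, e2, ← integral_add hmel hpowi]
  refine setIntegral_congr_fun measurableSet_Ioi fun x hx => ?_
  have hx0 : (x : ℂ) ≠ 0 := by
    exact_mod_cast (zero_lt_one.trans (mem_Ioi.1 hx)).ne'
  have h1 := hsum x
  have h2 : (x : ℂ) ^ (-s) = (x : ℂ) ^ (-s - 1) * x := by
    rw [Complex.cpow_sub _ _ hx0, Complex.cpow_one, div_mul_cancel₀ _ hx0]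
  rw [← Complex.ofReal_sum, h1, h2, neg_add']
  push_cast
  ring

lemma deriv_zetaMulSub_eq {s : ℂ} (hs : 1 < s.re) :
    deriv zetaMulSub s = zetaMulSub s * (-1 - s * mellin psiError (-s)) := by
  have hs1 : s ≠ 1 := by
    rintro rfl
    simp at hs
  have hs1' : s - 1 ≠ 0 := sub_ne_zero.2 hs1
  have hz := riemannZeta_ne_zero_of_one_le_re hs.le
  have := neg_deriv_zeta_div_zeta_eq h hs
  rw [div_eq_iff hz] at this
  have h2 : deriv riemannZeta s =
      -(s * (mellin psiError (-s) + 1 / (s - 1)) * riemannZeta s) := by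
    rw [← this, neg_neg]
  rw [deriv_zetaMulSub hs1, zetaMulSub_of_ne_one hs1, h2]
  field_simp
  ring

/-- The identity theorem extends `F' = F G`, with `G` analytic, from `Re s > 1` to `Re s > 1/2`. At
a zero of `F` of finite order, `F'` has order one less, while `F G` has order at least that of `F`.
-/
lemma zetaMulSub_ne_zero {s : ℂ} (hs : 1 / 2 < s.re) : zetaMulSub s ≠ 0 := by
  intro h0
  set U : Set ℂ := {z | 1 / 2 < z.re} with hU
  have hUo : IsOpen U := isOpen_lt continuous_const Complex.continuous_re
  have hUc : IsPreconnected U := (convex_halfSpace_re_gt _).isPreconnected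
  set G : ℂ → ℂ := fun z => -1 - z * mellin psiError (-z) with hG
  have hGd : DifferentiableOn ℂ G U := fun z hz => by
    have := differentiableAt_mellin_psiError h hz
    refine DifferentiableAt.differentiableWithinAt ?_
    exact (differentiableAt_const _).sub (differentiableAt_id.mul this)
  have hGa : AnalyticOnNhd ℂ G U := hGd.analyticOnNhd hUo
  have hFa : AnalyticOnNhd ℂ zetaMulSub univ :=
    differentiable_zetaMulSub.differentiableOn.analyticOnNhd isOpen_univ
  have hEq : EqOn (deriv zetaMulSub) (zetaMulSub * G) U := by
    refine (hFa.deriv.mono (subset_univ _)).eqOn_of_preconnected_of_eventuallyEq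
      ((hFa.mono (subset_univ _)).mul hGa) hUc (z₀ := 2) (by simp [hU]; norm_num) ?_
    have : {z : ℂ | 1 < z.re} ∈ 𝓝 (2 : ℂ) :=
      (isOpen_lt continuous_const Complex.continuous_re).mem_nhds (by simp)
    filter_upwards [this] with z hz using deriv_zetaMulSub_eq h hz
  have hFs := hFa s (mem_univ _)
  have htop : analyticOrderAt zetaMulSub s ≠ ⊤ := by
    intro ht
    rw [analyticOrderAt_eq_top] at ht
    have := hFa.eqOn_zero_of_preconnected_of_eventuallyEq_zero isPreconnected_univ (mem_univ s) ht
      (mem_univ (2 : ℂ))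
    rw [zetaMulSub_of_ne_one (by norm_num)] at this
    have h2 := riemannZeta_ne_zero_of_one_le_re (s := 2) (by simp)
    norm_num at this
    exact h2 this
  have hord := hFs.analyticOrderAt_deriv_add_one
  have hev : deriv zetaMulSub =ᶠ[𝓝 s] zetaMulSub * G :=
    hEq.eventuallyEq_of_mem (hUo.mem_nhds hs)
  rw [h0, analyticOrderAt_congr hev, analyticOrderAt_mul hFs (hGa s hs)] at hord
  simp only [sub_zero] at hord
  have hord' : analyticOrderAt zetaMulSub s + (analyticOrderAt G s + 1) =
      analyticOrderAt zetaMulSub s + 0 := by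
    rw [add_zero, ← add_assoc]; exact hord
  simpa using ENat.add_right_injective_of_ne_top htop hord'

lemma riemannZeta_ne_zero_of_half_lt_re {s : ℂ} (hs : 1 / 2 < s.re) : riemannZeta s ≠ 0 := by
  rcases eq_or_ne s 1 with rfl | h1
  · exact riemannZeta_one_ne_zero
  · have := zetaMulSub_ne_zero h hs
    rw [zetaMulSub_of_ne_one h1] at this
    exact right_ne_zero_of_mul this

/-- Square-root cancellation in the prime number theorem implies the Riemann hypothesis. -/
theorem riemannHypothesis_of_psi_sub_isBigO : RiemannHypothesis := by
  intro s hs htriv hs1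
  rcases lt_trichotomy s.re (1 / 2) with hlt | heq | hgt
  · exfalso
    obtain ⟨w, rfl⟩ : ∃ w, s = 1 - w := ⟨1 - s, by ring⟩
    have hw : 1 / 2 < w.re := by
      simp only [Complex.sub_re, Complex.one_re] at hlt; linarith
    have hwn : ∀ n : ℕ, w ≠ -n := by
      rintro n rfl
      simp only [Complex.neg_re, Complex.natCast_re] at hw
      linarith [n.cast_nonneg (α := ℝ)]
    have hw1 : w ≠ 1 := by
      rintro rfl
      rw [sub_self, riemannZeta_zero] at hs
      norm_num at hs
    rw [riemannZeta_one_sub hwn hw1] at hs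
    -- No other factor of the functional equation vanishes, so `w` is an odd integer; being positive
    -- and not `1`, it makes `1 - w` a trivial zero.
    have hcos : Complex.cos (Real.pi * w / 2) = 0 := by
      have hpi : (2 * Real.pi : ℂ) ≠ 0 := by
        exact_mod_cast Real.two_pi_pos.ne'
      have h1 : (2 * Real.pi : ℂ) ^ (-w) ≠ 0 := by
        rw [Ne, Complex.cpow_eq_zero_iff]; tauto
      have h2 := Complex.Gamma_ne_zero hwn
      have h3 := riemannZeta_ne_zero_of_half_lt_re h hw
      simpa [h1, h2, h3] using hs
    obtain ⟨k, hk⟩ := Complex.cos_eq_zero_iff.1 hcos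
    have hpi : (Real.pi : ℂ) ≠ 0 := by exact_mod_cast Real.pi_ne_zero
    have hwk : w = 2 * k + 1 := by
      have : (Real.pi : ℂ) * w = Real.pi * (2 * k + 1) := by linear_combination 2 * hk
      exact mul_left_cancel₀ hpi this
    have hk0 : 0 ≤ k := by
      rw [hwk] at hw
      simp at hw
      by_contra hneg
      have : (k : ℝ) ≤ -1 := by exact_mod_cast (by omega : k ≤ -1)
      linarith
    obtain ⟨m, rfl⟩ := Int.eq_ofNat_of_zero_le hk0
    rcases m with _ | m
    · apply hw1; simp [hwk]
    · apply htriv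
      refine ⟨m, ?_⟩
      rw [hwk]; push_cast; ring
  · exact heq
  · exact absurd hs (riemannZeta_ne_zero_of_half_lt_re h hgt)

end

/-! ### From `π - li` to `ψ(x) - x` -/

lemma primePi_mono {x y : ℝ} (h : x ≤ y) : primePi x ≤ primePi y := by
  unfold primePi
  exact_mod_cast Nat.monotone_primeCounting (Nat.floor_le_floor h)

/-- Partial summation for `θ`, minus the same identity for `li`, which holds because `li t * log t -
t` is an antiderivative of `li t / t`. -/
lemma theta_sub_eq {x : ℝ} (hx : 2 ≤ x) :
    Chebyshev.theta x - x = (primePi x - li x) * Real.log x -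
      (∫ t in 2..x, (primePi t - li t) / t) + (li 2 * Real.log 2 - 2) := by
  have hne : ∀ t ∈ uIcc 2 x, t ≠ 0 := fun t ht => by
    rw [uIcc_of_le hx] at ht
    linarith [ht.1]
  have hlt : ∀ t ∈ uIcc 2 x, 1 < t := fun t ht => by
    rw [uIcc_of_le hx] at ht
    linarith [ht.1]
  have hli : ContinuousOn li (uIcc 2 x) := fun t ht =>
    (hasDerivAt_li (hlt t ht)).continuousAt.continuousWithinAt
  have hi2 : IntervalIntegrable (fun t => li t / t) volume 2 x :=
    (hli.div continuousOn_id hne).intervalIntegrable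
  have hi1 : IntervalIntegrable (fun t => primePi t / t) volume 2 x := by
    have hm : Monotone primePi := fun _ _ => primePi_mono
    have := (hm.intervalIntegrable (μ := volume) (a := 2) (b := x)).mul_continuousOn
      (g := fun t => t⁻¹) (continuousOn_id.inv₀ hne)
    simpa only [div_eq_mul_inv] using this
  have hftc : ∫ t in 2..x, li t / t = (li x * Real.log x - x) - (li 2 * Real.log 2 - 2) := by
    refine intervalIntegral.integral_eq_sub_of_hasDerivAt
      (f := fun t => li t * Real.log t - t) (fun t ht => ?_) hi2
    have h1 := ((hasDerivAt_li (hlt t ht)).mul (Real.hasDerivAt_log (hne t ht))).sub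
      (hasDerivAt_id t)
    convert! h1 using 1
    rw [one_div_mul_cancel (Real.log_pos (hlt t ht)).ne', div_eq_mul_inv]
    ring
  have hsplit : ∫ t in 2..x, (primePi t - li t) / t =
      (∫ t in 2..x, primePi t / t) - ∫ t in 2..x, li t / t := by
    rw [← intervalIntegral.integral_sub hi1 hi2]
    simp only [sub_div]
  have hθ : Chebyshev.theta x = primePi x * Real.log x - ∫ t in 2..x, primePi t / t :=
    Chebyshev.theta_eq_primeCounting_mul_log_sub_integral hx
  rw [hθ, hsplit, hftc]
  ring

/-- Makes the asymptotic bound uniform on `[2, ∞)`, so that it can be integrated from `2`. -/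
lemma exists_forall_abs_primePi_sub_li_le {b : ℝ} (hb : 0 ≤ b)
    (h : (fun x => primePi x - li x) =O[atTop] fun x : ℝ => x ^ b) :
    ∃ K : ℝ, 0 ≤ K ∧ ∀ x : ℝ, 2 ≤ x → |primePi x - li x| ≤ K * x ^ b := by
  obtain ⟨c, hc⟩ := h.bound
  obtain ⟨X, hX⟩ := eventually_atTop.1 hc
  set Y := max X 2
  set K := max c (primePi Y + (|li 2| + |li Y|))
  have hπ : 0 ≤ primePi Y := Nat.cast_nonneg _
  refine ⟨K, le_max_of_le_right (by positivity), fun x hx => ?_⟩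
  have hx0 : 0 ≤ x ^ b := Real.rpow_nonneg (by linarith) b
  rcases le_or_gt X x with hXx | hXx
  · have := hX x hXx
    rw [Real.norm_eq_abs, Real.norm_of_nonneg hx0] at this
    exact this.trans (mul_le_mul_of_nonneg_right (le_max_left _ _) hx0)
  · have hxY : x ≤ Y := hXx.le.trans (le_max_left _ _)
    have h1 : 1 ≤ x ^ b := Real.one_le_rpow (by linarith) hb
    have h2 : li 2 ≤ li x := strictMonoOn_li.monotoneOn (mem_Ioi.2 one_lt_two)
      (mem_Ioi.2 (by linarith)) hx
    have h3 : li x ≤ li Y := strictMonoOn_li.monotoneOn (mem_Ioi.2 (by linarith))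
      (mem_Ioi.2 (by linarith)) hxY
    have h4 : primePi x ≤ primePi Y := primePi_mono hxY
    have h5 : 0 ≤ primePi x := Nat.cast_nonneg _
    have h6 : |primePi x - li x| ≤ primePi Y + (|li 2| + |li Y|) := by
      rw [abs_le]
      constructor
      · linarith [le_abs_self (li Y), abs_nonneg (li 2)]
      · linarith [neg_abs_le (li 2), abs_nonneg (li Y)]
    calc |primePi x - li x| ≤ K := h6.trans (le_max_right _ _)
      _ = K * 1 := (mul_one K).symm
      _ ≤ K * x ^ b := mul_le_mul_of_nonneg_left h1 (le_max_of_le_right (by positivity))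

lemma isBigO_const_rpow {b : ℝ} (hb : 0 < b) (c : ℝ) :
    (fun _ : ℝ => c) =O[atTop] fun x : ℝ => x ^ b :=
  (Asymptotics.isLittleO_const_left.2 (Or.inr
    (tendsto_norm_atTop_atTop.comp (tendsto_rpow_atTop hb)))).isBigO

lemma sqrt_isBigO_rpow {b : ℝ} (hb : 1 / 2 ≤ b) :
    (fun x : ℝ => √x) =O[atTop] fun x : ℝ => x ^ b := by
  refine Asymptotics.IsBigO.of_bound 1 ?_
  filter_upwards [eventually_ge_atTop 1] with x hx
  rw [Real.norm_of_nonneg (Real.sqrt_nonneg x),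
    Real.norm_of_nonneg (Real.rpow_nonneg (by linarith) b), one_mul, Real.sqrt_eq_rpow]
  exact Real.rpow_le_rpow_of_exponent_le hx hb

lemma rpow_mul_log_isBigO_rpow {a b : ℝ} (hab : a < b) :
    (fun x : ℝ => x ^ a * Real.log x) =O[atTop] fun x : ℝ => x ^ b := by
  have := (Asymptotics.isBigO_refl (fun x : ℝ => x ^ a) atTop).mul
    (isLittleO_log_rpow_atTop (sub_pos.2 hab)).isBigO
  refine this.congr' EventuallyEq.rfl ?_
  filter_upwards [eventually_gt_atTop 0] with x hx
  rw [← Real.rpow_add hx, add_sub_cancel]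

lemma integral_primePi_sub_li_isBigO {b : ℝ} (hb : 0 < b)
    (h : (fun x => primePi x - li x) =O[atTop] fun x : ℝ => x ^ b) :
    (fun x => ∫ t in 2..x, (primePi t - li t) / t) =O[atTop] fun x : ℝ => x ^ b := by
  obtain ⟨K, hK, hbound⟩ := exists_forall_abs_primePi_sub_li_le hb.le h
  refine Asymptotics.IsBigO.of_bound (K / b) ?_
  filter_upwards [eventually_ge_atTop 2] with x hx
  have hint : ∫ t in 2..x, K * t ^ (b - 1) = K * ((x ^ b - 2 ^ b) / b) := by
    rw [intervalIntegral.integral_const_mul, integral_rpow (Or.inl (by linarith)), sub_add_cancel]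
  have hle : ‖∫ t in 2..x, (primePi t - li t) / t‖ ≤ ∫ t in 2..x, K * t ^ (b - 1) := by
    refine intervalIntegral.norm_integral_le_of_norm_le hx ?_ ?_
    · refine Eventually.of_forall fun t ht => ?_
      have ht2 : 2 ≤ t := ht.1.le
      have ht0 : 0 < t := by linarith
      rw [norm_div, Real.norm_eq_abs, Real.norm_of_nonneg ht0.le, div_le_iff₀ ht0, mul_assoc,
        Real.rpow_sub_one ht0.ne', div_mul_cancel₀ _ ht0.ne']
      exact hbound t ht2
    · exact (intervalIntegral.intervalIntegrable_rpow' (by linarith)).const_mul K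
  rw [hint] at hle
  refine hle.trans ?_
  rw [Real.norm_of_nonneg (Real.rpow_nonneg (by linarith) b), div_mul_eq_mul_div, ← mul_div_assoc]
  refine div_le_div_of_nonneg_right (mul_le_mul_of_nonneg_left ?_ hK) hb.le
  linarith [Real.rpow_nonneg (zero_le_two (α := ℝ)) b]

lemma psi_sub_isBigO (h : ∀ b : ℝ, 1 / 2 < b →
    (fun x => primePi x - li x) =O[atTop] fun x : ℝ => x ^ b) {b : ℝ} (hb : 1 / 2 < b) :
    (fun x => Chebyshev.psi x - x) =O[atTop] fun x : ℝ => x ^ b := by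
  -- The gap between `a` and `b` absorbs the factor `log x`.
  obtain ⟨a, ha, hab⟩ := exists_between hb
  have h1 : (fun x => (primePi x - li x) * Real.log x) =O[atTop] fun x : ℝ => x ^ b :=
    ((h a ha).mul (Asymptotics.isBigO_refl _ _)).trans (rpow_mul_log_isBigO_rpow hab)
  have h2 := integral_primePi_sub_li_isBigO (by linarith) (h b hb)
  have h3 : (fun x => Chebyshev.theta x - x) =O[atTop] fun x : ℝ => x ^ b := by
    refine ((h1.sub h2).add (isBigO_const_rpow (by linarith) (li 2 * Real.log 2 - 2))).congr' ?_
      EventuallyEq.rfl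
    filter_upwards [eventually_ge_atTop 2] with x hx using (theta_sub_eq hx).symm
  have h4 := Chebyshev.isBigO_psi_sub_theta_sqrt.trans (sqrt_isBigO_rpow hb.le)
  refine (h4.add h3).congr_left fun x => ?_
  simp

/-! ### From multiples of `e^t` to all real arguments -/

lemma sqrt_mul_log_isBigO {b : ℝ} (hb : 1 / 2 < b) {A : ℝ} (hA : 0 < A) (c d : ℝ) :
    (fun x : ℝ => √(A * x) * (Real.log (A * x) + c) + d) =O[atTop] fun x : ℝ => x ^ b := by
  have h1 : (fun x : ℝ => √x * Real.log x) =O[atTop] fun x : ℝ => x ^ b := by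
    simpa only [Real.sqrt_eq_rpow] using rpow_mul_log_isBigO_rpow hb
  have h2 := (h1.const_mul_left √A).add
    ((sqrt_isBigO_rpow hb.le).const_mul_left (√A * (Real.log A + c)))
  refine (h2.add (isBigO_const_rpow (by linarith) d)).congr' ?_ EventuallyEq.rfl
  filter_upwards [eventually_gt_atTop 0] with x hx
  rw [Real.sqrt_mul hA.le, Real.log_mul hA.ne' hx.ne']
  ring

/-- A bound for `π - li` at the multiples of `e^t` extends to all large real arguments. -/
lemma primePi_sub_li_isBigO_of_nat {M t d : ℝ} (hM : 0 ≤ M) {N : ℕ}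
    (hN : soldner ≤ Real.exp t * N)
    (h : ∀ n : ℕ, N ≤ n → |primePi (Real.exp t * n) - li (Real.exp t * n)| ≤
      M * (√(n + 1) * (Real.log (n + 1) + |t|)) + d) {b : ℝ} (hb : 1 / 2 < b) :
    (fun x => primePi x - li x) =O[atTop] fun x : ℝ => x ^ b := by
  have he := Real.exp_pos t
  -- Chosen so that `m + 1 ≤ e^(-t) x + 2 ≤ A x` for `m ≤ n + 1` and `x ≥ 1`.
  set A : ℝ := Real.exp (-t) + 2
  have hA : 0 < A := by positivity
  -- Bounds the growth of `li` over one step of length `e^t` to the right of `μ`.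
  set L : ℝ := Real.exp t / Real.log soldner
  have hdom := ((sqrt_mul_log_isBigO hb hA |t| 0).const_mul_left M).add
    (isBigO_const_rpow (by linarith) (d + L))
  refine Asymptotics.IsBigO.trans (Asymptotics.IsBigO.of_bound 1 ?_) hdom
  filter_upwards [eventually_ge_atTop 1, eventually_ge_atTop (Real.exp t * (N + 1))] with x hx1 hxN
  set n := ⌊Real.exp (-t) * x⌋₊
  have hzero : 0 ≤ Real.exp (-t) * x := by positivity
  have hex : Real.exp t * (Real.exp (-t) * x) = x := by
    rw [← mul_assoc, ← Real.exp_add, add_neg_cancel, Real.exp_zero, one_mul]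
  have hn1 : Real.exp t * n ≤ x := by
    rw [← hex]
    exact mul_le_mul_of_nonneg_left (Nat.floor_le hzero) he.le
  have hn2 : x ≤ Real.exp t * (n + 1 : ℕ) := by
    rw [← hex]
    push_cast
    exact mul_le_mul_of_nonneg_left (Nat.lt_floor_add_one _).le he.le
  have hNn : N ≤ n := by
    apply Nat.le_floor
    refine le_of_mul_le_mul_left ?_ he
    rw [hex]; linarith
  have hs := soldner_le_of_le hN hNn
  have hs1 := one_lt_soldner
  have hbnd : ∀ m : ℕ, N ≤ m → m ≤ n + 1 →
      |primePi (Real.exp t * m) - li (Real.exp t * m)| ≤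
        M * (√(A * x) * (Real.log (A * x) + |t|)) + d := by
    intro m hm hmn
    refine (h m hm).trans ?_
    have hm' : (m : ℝ) ≤ n + 1 := by exact_mod_cast hmn
    have hle : (m : ℝ) + 1 ≤ A * x := by
      have := Nat.floor_le hzero
      change (n : ℝ) ≤ _ at this
      simp only [A]
      linarith
    have hm0 : (0 : ℝ) ≤ m := m.cast_nonneg
    have hlog : 0 ≤ Real.log ((m : ℝ) + 1) := Real.log_nonneg (by linarith)
    have hll : Real.log ((m : ℝ) + 1) ≤ Real.log (A * x) := Real.log_le_log (by linarith) hle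
    gcongr
  -- Since `π` and `li` increase, `π(x) - li(x)` lies between the errors at the two neighbouring
  -- multiples of `e^t`, up to `L`.
  have b1 := abs_le.1 (hbnd n hNn (by omega))
  have b2 := abs_le.1 (hbnd (n + 1) (by omega) le_rfl)
  have hone : 1 < Real.exp t * n := hs1.trans_le hs
  have hdiff : li (Real.exp t * (n + 1 : ℕ)) - li (Real.exp t * n) ≤ L := by
    refine (li_sub_le hone (hn1.trans hn2)).trans ?_
    have e1 : Real.exp t * (n + 1 : ℕ) - Real.exp t * n = Real.exp t := by push_cast; ring
    rw [e1]
    exact div_le_div_of_nonneg_left he.le (Real.log_pos hs1) (Real.log_le_log (by linarith) hs)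
  have l1 : li (Real.exp t * n) ≤ li x :=
    strictMonoOn_li.monotoneOn hone (hone.trans_le hn1) hn1
  have l2 : li x ≤ li (Real.exp t * (n + 1 : ℕ)) :=
    strictMonoOn_li.monotoneOn (hone.trans_le hn1) (hone.trans_le (hn1.trans hn2)) hn2
  have p1 := primePi_mono hn1
  have p2 := primePi_mono hn2
  rw [one_mul, Real.norm_eq_abs, Real.norm_eq_abs, add_zero]
  refine le_trans (abs_le.2 ⟨?_, ?_⟩) (le_abs_self _) <;> linarith [b1.1, b1.2, b2.1, b2.2]

/-! ### The four equivalences -/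

/-- Division by `e^t n = (e^(t/2) √n)²` passes between the counting and density forms. -/
lemma primeDensity_condition_iff {M t r lam X : ℝ} {n : ℕ} (hn : 0 < n) :
    |primeDensity (Real.exp t * n) - 1 / (n : ℝ) * harmonicSum t r n| ≤
        M / Real.exp (t / 2) * (X / √n) + lam / n ↔
    |primePi (Real.exp t * n) - Real.exp t * harmonicSum t r n| ≤
        M * Real.exp (t / 2) * √n * X + lam * Real.exp t := by
  have hn' : (0 : ℝ) < n := by exact_mod_cast hn
  have he := Real.exp_pos t
  have he2 := Real.exp_pos (t / 2)
  have hsq : 0 < √(n : ℝ) := Real.sqrt_pos.2 hn'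
  have hexp : Real.exp t = Real.exp (t / 2) ^ 2 := by
    rw [← Real.exp_nat_mul]; congr 1; push_cast; ring
  have hpos : 0 < Real.exp t * n := mul_pos he hn'
  have h1 : primeDensity (Real.exp t * n) - 1 / (n : ℝ) * harmonicSum t r n =
      (primePi (Real.exp t * n) - Real.exp t * harmonicSum t r n) / (Real.exp t * n) := by
    rw [primeDensity]; field_simp
  have h2 : M / Real.exp (t / 2) * (X / √n) + lam / n =
      (M * Real.exp (t / 2) * √n * X + lam * Real.exp t) / (Real.exp t * n) := by
    have hne := hn'.ne'
    rw [eq_div_iff hpos.ne', add_mul]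
    have e1 : lam / n * (Real.exp t * n) = lam * Real.exp t := by field_simp
    have e2 : M / Real.exp (t / 2) * (X / √n) * (Real.exp t * n) =
        M * Real.exp (t / 2) * √n * X := by
      have e3 : Real.exp t * n = Real.exp (t / 2) ^ 2 * √(n : ℝ) ^ 2 := by
        rw [hexp, Real.sq_sqrt hn'.le]
      rw [e3]; field_simp
    rw [e1, e2]
  rw [h1, h2, abs_div, abs_of_pos hpos, div_le_div_iff_of_pos_right hpos]

lemma exp_mul_betaSeq (t r : ℝ) (n : ℕ) :
    Real.exp t * betaSeq t r n = li (Real.exp t * n) - Real.exp t * harmonicSum t r n := by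
  rw [betaSeq, mul_sub, mul_div_cancel₀ _ (Real.exp_pos t).ne']

lemma riemannHypothesis_of_harmonic_bound {M C t r lam : ℝ} (hM : 0 < M)
    (hr : soldner * Real.exp (-t) ≤ (⌈r⌉ : ℝ))
    (h : ∀ n : ℕ, C * Real.exp (-t) ≤ (n : ℝ) →
      |primePi (Real.exp t * n) - Real.exp t * harmonicSum t r n| ≤
        M * Real.exp (t / 2) * √n *
          ((harmonic n : ℝ) - Real.eulerMascheroniConstant + t) + lam * Real.exp t) :
    RiemannHypothesis := by
  apply riemannHypothesis_of_psi_sub_isBigO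
  intro b hb
  refine psi_sub_isBigO (fun b hb => ?_) hb
  have he := Real.exp_pos t
  -- The first entry ensures `e^t N ≥ μ`, the second that the assumed bound applies.
  set N := max ⌈r⌉₊ ⌈C * Real.exp (-t)⌉₊
  have hN : soldner ≤ Real.exp t * N :=
    soldner_le_of_le (soldner_le_exp_mul_ceil hr) (le_max_left _ _)
  refine primePi_sub_li_isBigO_of_nat (M := M * Real.exp (t / 2))
    (d := lam * Real.exp t + Real.exp t * beta t r) (by positivity) hN (fun n hn => ?_) hb
  have hs := soldner_le_of_le hN hn
  have hCn : C * Real.exp (-t) ≤ n :=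
    (Nat.le_ceil _).trans (by exact_mod_cast (le_max_right _ _).trans hn)
  have h1 := h n hCn
  obtain ⟨hβ0, hβ1⟩ := betaSeq_mem_Icc hr hs
  have hβ := exp_mul_betaSeq t r n
  have h0 := mul_nonneg he.le hβ0
  have h2 := mul_le_mul_of_nonneg_left hβ1 he.le
  have hlog := add_log_pos hs
  have hlow := log_le_harmonic_sub (pos_of_soldner_le hs)
  have hup := harmonic_sub_le_log_add_one n
  -- Passing to `n + 1` and `|t|` gives a majorant with nonnegative increasing factors, as the
  -- extension to real arguments requires.
  have h3 : M * Real.exp (t / 2) * √n *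
        ((harmonic n : ℝ) - Real.eulerMascheroniConstant + t) ≤
      M * Real.exp (t / 2) * (√(n + 1) * (Real.log (n + 1) + |t|)) := by
    rw [mul_assoc (M * Real.exp (t / 2))]
    have hX : (harmonic n : ℝ) - Real.eulerMascheroniConstant + t ≤ Real.log (n + 1) + |t| :=
      add_le_add hup (le_abs_self t)
    have hX0 : 0 ≤ (harmonic n : ℝ) - Real.eulerMascheroniConstant + t := by linarith
    have hsq : √(n : ℝ) ≤ √(n + 1) := Real.sqrt_le_sqrt (by linarith)
    gcongr
  rw [abs_le] at h1 ⊢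
  constructor <;> linarith [h1.1, h1.2]

/-- The error is `(π - li)(e^t n)` plus a term in `[0, λ e^t]`, so the constant enters only once. -/
lemma harmonic_bound_of_riemannHypothesis {M C t r lam : ℝ} (hC : soldner ≤ C)
    (h : ∀ x : ℝ, C ≤ x → |primePi x - li x| ≤ M * √x * Real.log x)
    (hr : soldner * Real.exp (-t) ≤ (⌈r⌉ : ℝ)) (hlam : beta t r ≤ lam)
    {n : ℕ} (hn : C ≤ Real.exp t * n) :
    |primePi (Real.exp t * n) - Real.exp t * harmonicSum t r n| ≤
      M * Real.exp (t / 2) * √n * (t + Real.log n) + lam * Real.exp t := by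
  have hs := hC.trans hn
  have he := Real.exp_pos t
  have h1 := h _ hn
  have hn0 : (n : ℝ) ≠ 0 := by exact_mod_cast (pos_of_soldner_le hs).ne'
  have hsqrt : √(Real.exp t * n) = Real.exp (t / 2) * √n := by
    rw [Real.sqrt_mul he.le, Real.exp_half]
  rw [log_exp_mul t hn0, hsqrt, ← mul_assoc] at h1
  obtain ⟨hβ0, hβ1⟩ := betaSeq_mem_Icc hr hs
  have hβ := exp_mul_betaSeq t r n
  have h0 := mul_nonneg he.le hβ0
  have h2 := mul_le_mul_of_nonneg_left (hβ1.trans hlam) he.le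
  rw [abs_le] at h1 ⊢
  constructor <;> linarith [h1.1, h1.2]

end HarmonicRH

end

theorem theorem5p1 (M C : ℝ) (hM : 0 < M) (hC : HarmonicRH.soldner ≤ C)
    (hRH : RiemannHypothesis → ∀ x : ℝ, C ≤ x →
      |HarmonicRH.primePi x - HarmonicRH.li x| ≤ M * Real.sqrt x * Real.log x)
    (t r lam : ℝ) (hr : HarmonicRH.soldner * Real.exp (-t) ≤ (⌈r⌉ : ℝ))
    (hlam : HarmonicRH.beta t r ≤ lam) :
    (RiemannHypothesis ↔ ∀ n : ℕ, C * Real.exp (-t) ≤ (n : ℝ) →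
      |HarmonicRH.primePi (Real.exp t * n) - Real.exp t * HarmonicRH.harmonicSum t r n| ≤
        M * Real.exp (t / 2) * Real.sqrt n * (t + Real.log n) + lam * Real.exp t) ∧
    (RiemannHypothesis ↔ ∀ n : ℕ, C * Real.exp (-t) ≤ (n : ℝ) →
      |HarmonicRH.primePi (Real.exp t * n) - Real.exp t * HarmonicRH.harmonicSum t r n| ≤
        M * Real.exp (t / 2) * Real.sqrt n *
          ((harmonic n : ℝ) - Real.eulerMascheroniConstant + t) + lam * Real.exp t) ∧
    (RiemannHypothesis ↔ ∀ n : ℕ, C * Real.exp (-t) ≤ (n : ℝ) →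
      |HarmonicRH.primeDensity (Real.exp t * n) - 1 / (n : ℝ) * HarmonicRH.harmonicSum t r n| ≤
        M / Real.exp (t / 2) * ((t + Real.log n) / Real.sqrt n) + lam / n) ∧
    (RiemannHypothesis ↔ ∀ n : ℕ, C * Real.exp (-t) ≤ (n : ℝ) →
      |HarmonicRH.primeDensity (Real.exp t * n) - 1 / (n : ℝ) * HarmonicRH.harmonicSum t r n| ≤
        M / Real.exp (t / 2) *
          (((harmonic n : ℝ) - Real.eulerMascheroniConstant + t) / Real.sqrt n) + lam / n) := by
  have he := Real.exp_pos t
  have hadm : ∀ n : ℕ, C * Real.exp (-t) ≤ (n : ℝ) → C ≤ Real.exp t * n := by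
    intro n hn
    have := mul_le_mul_of_nonneg_left hn he.le
    rwa [mul_left_comm, ← Real.exp_add, add_neg_cancel, Real.exp_zero, mul_one] at this
  have hpos : ∀ n : ℕ, C * Real.exp (-t) ≤ (n : ℝ) → 0 < n := fun n hn =>
    HarmonicRH.pos_of_soldner_le (hC.trans (hadm n hn))
  have key1 : RiemannHypothesis → ∀ n : ℕ, C * Real.exp (-t) ≤ (n : ℝ) →
      |HarmonicRH.primePi (Real.exp t * n) - Real.exp t * HarmonicRH.harmonicSum t r n| ≤
        M * Real.exp (t / 2) * Real.sqrt n * (t + Real.log n) + lam * Real.exp t :=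
    fun hrh n hn =>
      HarmonicRH.harmonic_bound_of_riemannHypothesis hC (hRH hrh) hr hlam (hadm n hn)
  have key2 : ∀ n : ℕ, C * Real.exp (-t) ≤ (n : ℝ) →
      M * Real.exp (t / 2) * Real.sqrt n * (t + Real.log n) + lam * Real.exp t ≤
        M * Real.exp (t / 2) * Real.sqrt n *
          ((harmonic n : ℝ) - Real.eulerMascheroniConstant + t) + lam * Real.exp t := by
    intro n hn
    have hle : t + Real.log n ≤ (harmonic n : ℝ) - Real.eulerMascheroniConstant + t := by
      linarith [HarmonicRH.log_le_harmonic_sub (hpos n hn)]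
    gcongr
  have key3 := HarmonicRH.riemannHypothesis_of_harmonic_bound (C := C) (lam := lam) hM hr
  -- RH gives the sharpest bound, `log n ≤ H_n - γ` weakens it, and the weakest bound already
  -- returns RH.
  refine ⟨⟨key1, fun h => key3 fun n hn => (h n hn).trans (key2 n hn)⟩,
    ⟨fun h n hn => (key1 h n hn).trans (key2 n hn), key3⟩, ⟨fun h n hn => ?_, fun h => ?_⟩,
    ⟨fun h n hn => ?_, fun h => ?_⟩⟩
  · exact (HarmonicRH.primeDensity_condition_iff (hpos n hn)).2 (key1 h n hn)
  · exact key3 fun n hn => ((HarmonicRH.primeDensity_condition_iff (hpos n hn)).1 (h n hn)).trans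
      (key2 n hn)
  · exact (HarmonicRH.primeDensity_condition_iff (hpos n hn)).2
      ((key1 h n hn).trans (key2 n hn))
  · exact key3 fun n hn => (HarmonicRH.primeDensity_condition_iff (hpos n hn)).1 (h n hn)
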